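/- **Setting.** There are $n$ arms $1,\dots,n$ and a finite set $\mathcal G$ of at least two non-empty, possibly overlapping groups $G\subseteq\{1,\dots,n\}$, such that every arm is in at least one group. The rewards $X_{j,1},X_{j,2},\dots$ of arm $j$ are i.i.d. with mean $\mu_j\in[0,1]$ and are sub-Gaussian with parameter $R\le\frac12$: $\mathbb E[e^{\lambda(X_{j,s}-\mu_j)}]\le e^{\lambda^2R^2/2}$ for all $\lambda\in\mathbb R$. Write $\mu(G)=\min_{j\in G}\mu_j$, and assume that there is a unique optimal group, i.e. a $G^*\in\mathcal G$ with $\mu(G^*)>\mu(G)$ for all $G\in\mathcal G\setminus\{G^*\}$. Let $\Delta_G=\mu(G^*)-\mu(G)$ and $$\Delta_j'=\min_{G\ni j}(\mu_j-\mu(G)),\quad \Delta_j''=\min_{G\ni j}\Delta_G,\quad \Delta_0=\min_{G\ne G^*}\Delta_G,\quad \Delta_j=\max\{\Delta_j',\Delta_j'',\Delta_0\}.$$ **Algorithm (successive elimination with parameters $\epsilon,\delta$).** When arm $j$ has been pulled $T_j\ge1$ times, let $\hat\mu_j$ be the empirical mean of its first $T_j$ rewards, and let $\mathrm{UCB}(j)=\hat\mu_j+U(T_j,\frac{\delta}{n})$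 and $\mathrm{LCB}(j)=\hat\mu_j-U(T_j,\frac{\delta}{n})$, where $$U(t,\eta)=(1+\sqrt\epsilon)\sqrt{\frac{1+\epsilon}{2t}\log\frac{\log((1+\epsilon)t)}{\eta}};$$ if $T_j=0$, let $\mathrm{UCB}(j)=+\infty$ and $\mathrm{LCB}(j)=-\infty$. Write $\mathrm{UCB}_i$, $\mathrm{LCB}_i$ for these bounds at the start of epoch $i=0,1,2,\dots$. Start with $m_0^{(G)}=G$ for $G\in\mathcal G$, $\mathcal C_0=\mathcal G$, $\mathcal A_0=\{1,\dots,n\}$. While $|\mathcal C_i|>1$, run epoch $i$: pull every arm of $\mathcal A_i$ once and set $$m_{i+1}^{(G)}=\Big\{j\in G:\mathrm{LCB}_{i+1}(j)\le\min_{j'\in G}\mathrm{UCB}_{i+1}(j')\Big\},$$ $$\mathcal C_{i+1}=\Big\{G\in\mathcal C_i:\min_{j'\in m_i^{(G')}}\mathrm{LCB}_i(j')\le\min_{j\in m_i^{(G)}}\mathrm{UCB}_i(j)\ \text{ for all } G'\in\mathcal C_i\Big\},$$ $$\mathcal A_{i+1}=\Big\{j\in\mathcal A_i: j\in m_{i+1}^{(G)}\text{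 for at least one }G\in\mathcal C_{i+1}\Big\}$$ (eliminated arms are never pulled again). When $|\mathcal C_i|\le1$, stop and return $\mathcal C_i$. **Theorem (Upper bound for successive elimination).** Let $\epsilon\in(0,1)$, $\delta\in\big(0,\tfrac1e\log(1+\epsilon)\big)$ and $\gamma=8(1+\sqrt\epsilon)^2(1+\epsilon)$. With probability at least $$1-\frac{2+\epsilon}{\epsilon/2}\Big(\frac{\delta}{\log(1+\epsilon)}\Big)^{1+\epsilon}$$ the algorithm stops, returns $\{G^*\}$, and the total number of arm pulls is at most $$\sum_{j=1}^n\frac{2\gamma}{\Delta_j^2}\,\log\frac{2\log\big(\gamma(1+\epsilon)\Delta_j^{-2}\big)}{\delta/n}.$$ -/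

import Mathlib

open MeasureTheory ProbabilityTheory
open scoped NNReal

namespace MaxMinBandit

/-- A max-min grouped bandit instance with arms `Fin n`: a set of non-empty, possibly overlapping
groups covering all arms, and a reward distribution on `ℝ` for each arm. -/
structure Instance (n : ℕ) where
  groups : Finset (Finset (Fin n))
  groups_nonempty : ∀ G ∈ groups, G.Nonempty
  cover : ∀ j : Fin n, ∃ G ∈ groups, j ∈ G
  law : Fin n → Measure ℝ
  law_prob : ∀ j, IsProbabilityMeasure (law j)

namespace Instance

variable {n : ℕ} (I : Instance n)

/-- The mean reward `μ_j` of arm `j`. -/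
noncomputable def mean (j : Fin n) : ℝ := ∫ x, x ∂(I.law j)

/-- The mean of the worst arm of the (non-empty) group `G`, that is `min_{j ∈ G} μ_j`. -/
noncomputable def worstMean (G : Finset (Fin n)) : ℝ := ⨅ j : {j // j ∈ G}, I.mean j

/-- All arm means lie in `[0,1]`, and all reward distributions are sub-Gaussian with
parameter `R`: `E[exp (l (X - μ_j))] ≤ exp (l² R² / 2)` for all real `l`. -/
def SubGaussianRewards (R : ℝ≥0) : Prop :=
  ∀ j, I.mean j ∈ Set.Icc (0 : ℝ) 1 ∧
    HasSubgaussianMGF (fun x : ℝ => x - I.mean j) (R ^ 2) (I.law j)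

/-- `Gs` is the unique max-min optimal group. -/
def IsUniqueOptimal (Gs : Finset (Fin n)) : Prop :=
  Gs ∈ I.groups ∧ ∀ G ∈ I.groups, G ≠ Gs → I.worstMean G < I.worstMean Gs

/-- `Δ_G`, the gap between the worst arm of the optimal group `Gs` and the worst arm of `G`. -/
noncomputable def groupGap (Gs G : Finset (Fin n)) : ℝ := I.worstMean Gs - I.worstMean G

/-- `Δ'_j`, the minimum of `μ_j - min_{G} μ` over the groups `G` containing `j`. -/
noncomputable def gapWithin (j : Fin n) : ℝ :=
  ⨅ G : {G // G ∈ I.groups ∧ j ∈ G}, (I.mean j - I.worstMean G)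

/-- `Δ''_j`, the minimum of `Δ_G` over the groups `G` containing `j`. -/
noncomputable def gapAcross (Gs : Finset (Fin n)) (j : Fin n) : ℝ :=
  ⨅ G : {G // G ∈ I.groups ∧ j ∈ G}, I.groupGap Gs G

/-- `Δ_0`, the minimum of `Δ_G` over the groups `G` other than the optimal group `Gs`. -/
noncomputable def gapZero (Gs : Finset (Fin n)) : ℝ :=
  ⨅ G : {G // G ∈ I.groups ∧ G ≠ Gs}, I.groupGap Gs G

/-- The overall gap `Δ_j = max {Δ'_j, Δ''_j, Δ_0}` of arm `j`. -/
noncomputable def gap (Gs : Finset (Fin n)) (j : Fin n) : ℝ :=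
  max (I.gapWithin j) (max (I.gapAcross Gs j) (I.gapZero Gs))

/-- A model of the rewards: `X j s` is the reward of the `(s+1)`-st pull of arm `j`. For each
arm, its rewards are i.i.d. with the distribution of that arm. -/
structure IsRewardModel {Ω : Type*} [MeasurableSpace Ω] (P : Measure Ω)
    (X : Fin n → ℕ → Ω → ℝ) : Prop where
  measurable : ∀ j s, Measurable (X j s)
  map_eq : ∀ j s, P.map (X j s) = I.law j
  indep : ∀ j, iIndepFun (X j) P

end Instance

/-- The confidence width `U(t, η) = (1 + √ε) √((1 + ε) / (2t) · log (log ((1 + ε) t) / η))`. -/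
noncomputable def width (ε : ℝ) (t : ℕ) (η : ℝ) : ℝ :=
  (1 + √ε) * √((1 + ε) / (2 * t) * Real.log (Real.log ((1 + ε) * t) / η))

/-- The empirical mean of the first `k` rewards of an arm with reward sequence `x`. -/
noncomputable def empMean (x : ℕ → ℝ) (k : ℕ) : ℝ := (∑ s ∈ Finset.range k, x s) / k

section Algorithm

variable {n : ℕ}

/-- The upper confidence bound of arm `j` when each arm `i` has been pulled `T i` times and the
rewards are given by the table `x`; it is `⊤` for an arm that has not been pulled yet. -/
noncomputable def ucb (ε δ : ℝ) (x : Fin n → ℕ → ℝ) (T : Fin n → ℕ) (j : Fin n) : EReal :=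
  if T j = 0 then ⊤ else ((empMean (x j) (T j) + width ε (T j) (δ / n) : ℝ) : EReal)

/-- The lower confidence bound of arm `j`; it is `⊥` for an arm that has not been pulled yet. -/
noncomputable def lcb (ε δ : ℝ) (x : Fin n → ℕ → ℝ) (T : Fin n → ℕ) (j : Fin n) : EReal :=
  if T j = 0 then ⊥ else ((empMean (x j) (T j) - width ε (T j) (δ / n) : ℝ) : EReal)

/-- The potential worst arms of `G`, given the numbers of pulls `T`. -/
noncomputable def potentialWorst (ε δ : ℝ) (x : Fin n → ℕ → ℝ) (T : Fin n → ℕ)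
    (G : Finset (Fin n)) : Finset (Fin n) :=
  {j ∈ G | lcb ε δ x T j ≤ G.inf (ucb ε δ x T)}

/-- The state of successive elimination at the start of an epoch: the number of pulls of each
arm so far, the sets `m^(G)` of potential worst arms, the candidate groups `C` and the candidate
arms `A`. -/
structure State (n : ℕ) where
  pulls : Fin n → ℕ
  worst : Finset (Fin n) → Finset (Fin n)
  cand : Finset (Finset (Fin n))
  arms : Finset (Fin n)

/-- The total number of arm pulls so far. -/
def State.totalPulls (S : State n) : ℕ := ∑ j, S.pulls j

/-- The initial state for the set of groups `𝒢`. -/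
def State.start (𝒢 : Finset (Finset (Fin n))) : State n where
  pulls := fun _ => 0
  worst := fun G => G
  cand := 𝒢
  arms := Finset.univ

/-- One epoch: pull every candidate arm once, then update the potential worst arms, the candidate
groups and the candidate arms. The new set of candidate groups is computed from the confidence
bounds and the potential worst arms at the start of the epoch; arms that have been eliminated are
not pulled again. -/
noncomputable def State.step (ε δ : ℝ) (x : Fin n → ℕ → ℝ) (S : State n) : State n :=
  let T : Fin n → ℕ := fun j => if j ∈ S.arms then S.pulls j + 1 else S.pulls j
  let m : Finset (Fin n) → Finset (Fin n) := potentialWorst ε δ x T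
  let C : Finset (Finset (Fin n)) :=
    {G ∈ S.cand | ∀ G' ∈ S.cand,
      (S.worst G').inf (lcb ε δ x S.pulls) ≤ (S.worst G).inf (ucb ε δ x S.pulls)}
  { pulls := T
    worst := m
    cand := C
    arms := {j ∈ S.arms | ∃ G ∈ C, j ∈ m G} }

/-- The state at the start of epoch `i`, if the loop has not been left before. -/
noncomputable def state (𝒢 : Finset (Finset (Fin n))) (ε δ : ℝ) (x : Fin n → ℕ → ℝ) (i : ℕ) :
    State n :=
  (State.step ε δ x)^[i] (State.start 𝒢)

/-- On the reward table `x`, successive elimination (which runs epochs as long as there is more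
than one candidate group) stops in the state `S`. -/
def StopsIn (𝒢 : Finset (Finset (Fin n))) (ε δ : ℝ) (x : Fin n → ℕ → ℝ) (S : State n) : Prop :=
  ∃ i, state 𝒢 ε δ x i = S ∧ ¬ 1 < S.cand.card ∧ ∀ k < i, 1 < (state 𝒢 ε δ x k).cand.card

end Algorithm

/-- The constant `γ = 8 (1 + √ε)² (1 + ε)`. -/
noncomputable def gam (ε : ℝ) : ℝ := 8 * (1 + √ε) ^ 2 * (1 + ε)

end MaxMinBandit

/-! On an event of the stated probability, every empirical mean stays within its confidence width at
all times (`IsRewardModel.exists_confidence_event`); everything afterwards is deterministic on that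
event.

The event comes from a finite law of the iterated logarithm, `measure_exists_width_lt_sum`. Time is
cut into blocks at `⌈(1+ε)^k⌉`. The partial sum at the start of a block is controlled by Hoeffding's
inequality and the increments inside the block by its maximal form. Both failure probabilities are
of order `(k+1)^(-(1+ε))`, hence summable. A union bound over signs and arms gives the event.

On the event, the optimal group is never discarded and the worst arm of a candidate group is never
dropped. A group `G` that passes the test made with the bounds of epoch `i` satisfies `Δ_G ≤ 4U(i)`,
and an arm that remains potentially worst in a candidate group `G` satisfies `μ_j - μ(G) ≤ 4U(i)`.
So an arm active while the loop runs satisfies `Δ_j ≤ 4U(i)` (`gap_le`). Inverting this inequality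
(`natCast_add_two_le_of_le_four_mul_width`) bounds the pulls of each arm; the same inversion for
`Δ_0` forces the loop to stop. -/

namespace MaxMinBandit

/-! ### Maximal inequality for sums of independent sub-Gaussian variables. -/

section Concentration

variable {Ω : Type*} [MeasurableSpace Ω] {P : Measure Ω}

/-- By independence, one more summand multiplies the conditional expectation by `E[exp (l Z)]`,
which is at least `1 + l E[Z] = 1` for centred variables. This feeds Doob's maximal inequality. -/
lemma submartingale_exp_sum {Z : ℕ → Ω → ℝ} {c : ℝ≥0} (hm : ∀ i, Measurable (Z i))
    (hi : iIndepFun Z P) (hs : ∀ i, HasSubgaussianMGF (Z i) c P) (h0 : ∀ i, ∫ ω, Z i ω ∂P = 0)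
    (l : ℝ) :
    Submartingale (fun i ω => Real.exp (l * ∑ s ∈ Finset.range (i + 1), Z s ω))
      (Filtration.natural Z fun i => (hm i).stronglyMeasurable) P := by
  have := hi.isProbabilityMeasure
  set ℱ := Filtration.natural Z fun i => (hm i).stronglyMeasurable
  have hint : ∀ i, Integrable (fun ω => Real.exp (l * ∑ s ∈ Finset.range (i + 1), Z s ω)) P :=
    fun i => (HasSubgaussianMGF.sum_of_iIndepFun hi (c := fun _ => c)
      (s := Finset.range (i + 1)) fun i _ => hs i).integrable_exp_mul l
  have hZ : ∀ {s i}, s ≤ i → Measurable[ℱ i] (Z s) := fun {s i} h =>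
    ((Filtration.stronglyAdapted_natural fun i => (hm i).stronglyMeasurable) s).measurable.mono
      (ℱ.mono h) le_rfl
  have had : StronglyAdapted ℱ fun i ω => Real.exp (l * ∑ s ∈ Finset.range (i + 1), Z s ω) := by
    intro i
    refine Measurable.stronglyMeasurable ?_
    refine Real.measurable_exp.comp (Measurable.const_mul ?_ l)
    exact Finset.measurable_fun_sum _ fun s hs => hZ (by simpa [Nat.lt_succ_iff] using hs)
  refine submartingale_nat had hint fun i => ?_
  have hE : Integrable (fun ω => Real.exp (l * Z (i + 1) ω)) P := (hs (i + 1)).integrable_exp_mul l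
  have hsplit : (fun ω => Real.exp (l * ∑ s ∈ Finset.range (i + 1 + 1), Z s ω)) =
      (fun ω => Real.exp (l * ∑ s ∈ Finset.range (i + 1), Z s ω)) *
        fun ω => Real.exp (l * Z (i + 1) ω) := by
    funext ω
    rw [Finset.sum_range_succ, mul_add, Real.exp_add]; rfl
  have h1 := condExp_mul_of_stronglyMeasurable_left (had i) (hsplit ▸ hint (i + 1)) hE
  have h2 : P[fun ω => Real.exp (l * Z (i + 1) ω) | ℱ i] =ᵐ[P]
      fun _ => P[fun ω => Real.exp (l * Z (i + 1) ω)] :=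
    condExp_indep_eq (hm (i + 1)).comap_le (ℱ.le i)
      (Real.measurable_exp.comp ((comap_measurable (Z (i + 1))).const_mul l)).stronglyMeasurable
      (hi.indep_comap_natural_of_lt (fun i => (hm i).stronglyMeasurable) (Nat.lt_succ_self i))
  have h3 : 1 ≤ P[fun ω => Real.exp (l * Z (i + 1) ω)] := by
    calc (1 : ℝ) = ∫ ω, (l * Z (i + 1) ω + 1) ∂P := by
          rw [integral_add ((hs (i + 1)).integrable.const_mul l) (integrable_const _),
            integral_const_mul, h0]; simp
      _ ≤ _ := integral_mono (((hs (i + 1)).integrable.const_mul l).add (integrable_const _)) hE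
          fun ω => Real.add_one_le_exp _
  rw [hsplit]
  filter_upwards [h1, h2] with ω h1 h2
  rw [h1, Pi.mul_apply, h2]
  exact le_mul_of_one_le_right (Real.exp_pos _).le h3

/-- Maximal form of Hoeffding's inequality. -/
lemma measure_exists_sum_range_ge_le {Z : ℕ → Ω → ℝ} {c : ℝ≥0} (hc : 0 < c)
    (hm : ∀ i, Measurable (Z i)) (hi : iIndepFun Z P) (hs : ∀ i, HasSubgaussianMGF (Z i) c P)
    (h0 : ∀ i, ∫ ω, Z i ω ∂P = 0) {a : ℝ} (ha : 0 ≤ a) (n : ℕ) :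
    P {ω | ∃ i ≤ n, a ≤ ∑ s ∈ Finset.range (i + 1), Z s ω} ≤
      ENNReal.ofReal (Real.exp (-a ^ 2 / (2 * (n + 1 : ℕ) * c))) := by
  have := hi.isProbabilityMeasure
  have hc' : (0 : ℝ) < c := hc
  -- The minimiser of the Chernoff exponent `(n + 1) c l² / 2 - l a`.
  set l : ℝ := a / ((n + 1 : ℕ) * c) with hl
  have hl0 : 0 ≤ l := by positivity
  have hsub := submartingale_exp_sum hm hi hs h0 l
  have hmax := maximal_ineq hsub (fun i ω => (Real.exp_pos _).le)
    (ε := (Real.exp (l * a)).toNNReal) n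
  rw [Real.coe_toNNReal _ (Real.exp_pos _).le] at hmax
  set S := {ω | ∃ i ≤ n, a ≤ ∑ s ∈ Finset.range (i + 1), Z s ω} with hS
  have hsum := HasSubgaussianMGF.sum_of_iIndepFun hi (c := fun _ => c)
      (s := Finset.range (n + 1)) fun i _ => hs i
  have hmgf := hsum.mgf_le l
  have hle : ENNReal.ofReal (Real.exp (l * a)) * P S ≤
      ENNReal.ofReal (Real.exp ((n + 1 : ℕ) * c * l ^ 2 / 2)) := by
    refine le_trans ?_ (hmax.trans (ENNReal.ofReal_le_ofReal ?_))
    · change ((Real.exp (l * a)).toNNReal : ENNReal) * P S ≤ _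
      gcongr
      rintro ω ⟨i, hi, h⟩
      refine (Real.exp_le_exp.2 (mul_le_mul_of_nonneg_left h hl0)).trans ?_
      exact Finset.le_sup' (fun k => Real.exp (l * ∑ s ∈ Finset.range (k + 1), Z s ω))
        (Finset.mem_range.2 (Nat.lt_succ_of_le hi))
    · refine (setIntegral_le_integral (hsub.integrable n)
        (ae_of_all _ fun ω => (Real.exp_pos _).le)).trans (hmgf.trans (le_of_eq ?_))
      simp
  have hpos : (0 : ℝ) < Real.exp (l * a) := Real.exp_pos _
  have hle2 : P S ≤ ENNReal.ofReal (Real.exp ((n + 1 : ℕ) * c * l ^ 2 / 2)) /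
      ENNReal.ofReal (Real.exp (l * a)) := by
    rw [ENNReal.le_div_iff_mul_le (by simp [Real.exp_pos]) (by simp), mul_comm]
    exact hle
  refine hle2.trans (le_of_eq ?_)
  rw [← ENNReal.ofReal_div_of_pos hpos, ← Real.exp_sub]
  congr 2
  rw [hl]
  field_simp
  ring

end Concentration

/-! ### The tail of the series with exponent `1 + ε`. -/

section Series

/-- A telescoping substitute for integral comparison. With `a = m + 1` and `b = m + 2`, `log (b / a)
≥ 1 - a / b = 1 / b` gives `(b / a) ^ ε ≥ 1 + ε / b`. -/
lemma inv_rpow_one_add_le {ε : ℝ} (hε : 0 < ε) (m : ℕ) :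
    ((m + 2 : ℕ) : ℝ) ^ (-(1 + ε)) ≤
      ε⁻¹ * (((m + 1 : ℕ) : ℝ) ^ (-ε) - ((m + 2 : ℕ) : ℝ) ^ (-ε)) := by
  have h1 : (0 : ℝ) < (m + 1 : ℕ) := by positivity
  have h2 : (0 : ℝ) < (m + 2 : ℕ) := by positivity
  set a : ℝ := ((m + 1 : ℕ) : ℝ) with ha
  set b : ℝ := ((m + 2 : ℕ) : ℝ) with hb
  have hab : b = a + 1 := by rw [ha, hb]; push_cast; ring
  have key : 1 + ε / b ≤ (b / a) ^ ε := by
    rw [Real.rpow_def_of_pos (by positivity)]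
    have h3 : 1 - (b / a)⁻¹ ≤ Real.log (b / a) := Real.one_sub_inv_le_log_of_pos (by positivity)
    have h4 : 1 - (b / a)⁻¹ = 1 / b := by rw [hab]; field_simp; ring
    have h5 := Real.add_one_le_exp (Real.log (b / a) * ε)
    have h6 : ε / b ≤ Real.log (b / a) * ε := by
      rw [h4] at h3
      calc ε / b = 1 / b * ε := by ring
        _ ≤ _ := by gcongr
    linarith
  have h7 : (b / a) ^ ε = a ^ (-ε) * b ^ ε := by
    rw [Real.div_rpow h2.le h1.le, Real.rpow_neg h1.le]; ring
  have h8 : b ^ (-(1 + ε)) = b ^ (-ε) / b := by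
    rw [show -(1 + ε) = -ε - 1 by ring, Real.rpow_sub_one h2.ne']
  have h9 : b ^ ε * b ^ (-ε) = 1 := by rw [← Real.rpow_add h2]; simp
  have hbp : 0 < b ^ (-ε) := Real.rpow_pos_of_pos h2 _
  have h10 : b ^ (-ε) * (1 + ε / b) ≤ a ^ (-ε) := by
    calc b ^ (-ε) * (1 + ε / b) ≤ b ^ (-ε) * (b / a) ^ ε := by gcongr
      _ = a ^ (-ε) * (b ^ ε * b ^ (-ε)) := by rw [h7]; ring
      _ = a ^ (-ε) := by rw [h9, mul_one]
  rw [h8, le_inv_mul_iff₀ hε]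
  have : b ^ (-ε) * (1 + ε / b) = b ^ (-ε) + ε * (b ^ (-ε) / b) := by ring
  linarith

lemma sum_inv_rpow_one_add_le {ε : ℝ} (hε : 0 < ε) (N : ℕ) :
    ∑ k ∈ Finset.range N, ((k + 2 : ℕ) : ℝ) ^ (-(1 + ε)) ≤ ε⁻¹ := by
  have h : ∑ k ∈ Finset.range N, ((k + 2 : ℕ) : ℝ) ^ (-(1 + ε)) ≤
      ε⁻¹ * (1 - ((N + 1 : ℕ) : ℝ) ^ (-ε)) := by
    induction N with
    | zero => simp
    | succ N ih =>
      rw [Finset.sum_range_succ]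
      have := inv_rpow_one_add_le hε N
      rw [mul_sub] at *
      rw [show N + 1 + 1 = N + 2 by ring]
      linarith
  refine h.trans (mul_le_of_le_one_right (by positivity) ?_)
  have : 0 ≤ ((N + 1 : ℕ) : ℝ) ^ (-ε) := by positivity
  linarith

end Series

/-- The boundary `√((1 + ε) x / 2 · log (log ((1 + ε) x) / η))` for the partial sums of `x`
sub-Gaussian variables. -/
noncomputable def boundary (ε η x : ℝ) : ℝ :=
  √((1 + ε) * x / 2 * Real.log (Real.log ((1 + ε) * x) / η))

/-! ### Monotonicity and tail size of the iterated-logarithm boundary. -/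

section Boundary

variable {ε η : ℝ}

lemma natCast_mul_width (t : ℕ) : t * width ε t η = (1 + √ε) * boundary ε η t := by
  rcases Nat.eq_zero_or_pos t with rfl | ht
  · simp [boundary]
  have ht' : (0 : ℝ) < t := by exact_mod_cast ht
  rw [width, boundary, mul_left_comm]
  congr 1
  nth_rw 1 [← Real.sqrt_sq ht'.le]
  rw [← Real.sqrt_mul (sq_nonneg _)]
  congr 1
  field_simp

/-- This is where `η < log (1 + ε) / e` matters: it keeps the radicands positive, so that
`Real.sqrt` does not truncate. -/
lemma one_le_log_log_div (hε : 0 < ε) (hη : η ∈ Set.Ioo (0 : ℝ) (Real.log (1 + ε) / Real.exp 1))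
    {x : ℝ} (hx : 1 ≤ x) : 1 ≤ Real.log (Real.log ((1 + ε) * x) / η) := by
  have h1 : Real.exp 1 * η < Real.log (1 + ε) := by
    have := hη.2
    rwa [lt_div_iff₀ (Real.exp_pos 1), mul_comm] at this
  have h2 : Real.log (1 + ε) ≤ Real.log ((1 + ε) * x) :=
    Real.log_le_log (by positivity) (le_mul_of_one_le_right (by positivity) hx)
  have h3 : Real.exp 1 ≤ Real.log ((1 + ε) * x) / η := by
    rw [le_div_iff₀ hη.1]; linarith
  exact (Real.le_log_iff_exp_le ((Real.exp_pos 1).trans_le h3)).2 h3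

lemma boundary_mono (hε : 0 < ε) (hη : η ∈ Set.Ioo (0 : ℝ) (Real.log (1 + ε) / Real.exp 1))
    {x y : ℝ} (hx : 1 ≤ x) (hxy : x ≤ y) : boundary ε η x ≤ boundary ε η y := by
  have h1 := one_le_log_log_div hε hη hx
  have h0 : 0 < Real.log ((1 + ε) * x) := Real.log_pos (by nlinarith)
  refine Real.sqrt_le_sqrt (mul_le_mul (by gcongr) ?_ (by linarith) (by nlinarith))
  refine Real.log_le_log (div_pos h0 hη.1) ?_
  have := hη.1
  gcongr

lemma boundary_sq (hε : 0 < ε) (hη : η ∈ Set.Ioo (0 : ℝ) (Real.log (1 + ε) / Real.exp 1))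
    {x : ℝ} (hx : 1 ≤ x) :
    boundary ε η x ^ 2 = (1 + ε) * x / 2 * Real.log (Real.log ((1 + ε) * x) / η) := by
  have h1 := one_le_log_log_div hε hη hx
  exact Real.sq_sqrt (mul_nonneg (by nlinarith) (by linarith))

lemma exp_neg_log_log_le (hε : 0 < ε) (hη : η ∈ Set.Ioo (0 : ℝ) (Real.log (1 + ε) / Real.exp 1))
    {x : ℝ} {k : ℕ} (hx : (1 + ε) ^ k ≤ x) :
    Real.exp (-((1 + ε) * Real.log (Real.log ((1 + ε) * x) / η))) ≤
      (η / Real.log (1 + ε)) ^ (1 + ε) * ((k + 1 : ℕ) : ℝ) ^ (-(1 + ε)) := by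
  have hL : 0 < Real.log (1 + ε) := Real.log_pos (by linarith)
  have h1 : ((k + 1 : ℕ) : ℝ) * Real.log (1 + ε) ≤ Real.log ((1 + ε) * x) := by
    rw [← Real.log_pow]
    refine Real.log_le_log (by positivity) ?_
    rw [pow_succ']
    gcongr
  have hη0 := hη.1
  have hk : (0 : ℝ) < (k + 1 : ℕ) := by positivity
  have hpos : 0 < ((k + 1 : ℕ) : ℝ) * Real.log (1 + ε) / η := by positivity
  have h2 : Real.log (((k + 1 : ℕ) : ℝ) * Real.log (1 + ε) / η) ≤
      Real.log (Real.log ((1 + ε) * x) / η) := Real.log_le_log hpos (by gcongr)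
  calc Real.exp (-((1 + ε) * Real.log (Real.log ((1 + ε) * x) / η)))
      ≤ Real.exp (-((1 + ε) * Real.log (((k + 1 : ℕ) : ℝ) * Real.log (1 + ε) / η))) := by gcongr
    _ = (((k + 1 : ℕ) : ℝ) * Real.log (1 + ε) / η) ^ (-(1 + ε)) := by
        rw [Real.rpow_def_of_pos hpos]; congr 1; ring
    _ = _ := by
        rw [mul_div_assoc, Real.mul_rpow hk.le (by positivity), mul_comm,
          Real.rpow_neg (by positivity) (1 + ε), ← Real.inv_rpow (by positivity), inv_div]

end Boundary

/-! ### Finite law of the iterated logarithm by geometric blocks. -/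

section IteratedLogarithm

variable {Ω : Type*} [MeasurableSpace Ω] {P : Measure Ω} {Y : ℕ → Ω → ℝ} {ε η : ℝ}

/-- With variance proxy `u / 4`, Hoeffding's exponent is `-2 b² / u`, and the factor `(1 + ε) u / 2`
in the squared boundary `b²` turns it into `-(1 + ε) log (…)`. -/
lemma measure_boundary_le_sum (hi : iIndepFun Y P)
    (hs : ∀ i, HasSubgaussianMGF (Y i) (1 / 4) P)
    (hε : 0 < ε) (hη : η ∈ Set.Ioo (0 : ℝ) (Real.log (1 + ε) / Real.exp 1)) {k u : ℕ}
    (hu : 1 ≤ u) (hku : (1 + ε) ^ k ≤ (u : ℝ)) :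
    P {ω | boundary ε η u ≤ ∑ s ∈ Finset.range u, Y s ω} ≤
      ENNReal.ofReal ((η / Real.log (1 + ε)) ^ (1 + ε) * ((k + 1 : ℕ) : ℝ) ^ (-(1 + ε))) := by
  have := hi.isProbabilityMeasure
  have hu' : (1 : ℝ) ≤ u := by exact_mod_cast hu
  have h := HasSubgaussianMGF.measure_sum_range_ge_le_of_iIndepFun hi (n := u)
    (fun i _ => hs i) (ε := boundary ε η u) (Real.sqrt_nonneg _)
  rw [← ofReal_measureReal]
  refine ENNReal.ofReal_le_ofReal (h.trans (le_trans (le_of_eq ?_) (exp_neg_log_log_le hε hη hku)))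
  rw [boundary_sq hε hη hu']
  congr 1
  push_cast
  field_simp
  ring

/-- A block has at most `ε u` increments, so its variance proxy is smaller by a factor `ε`; a
threshold smaller by `√ε` therefore has the same tail bound. This is the origin of `1 + √ε` in the
width. -/
lemma measure_exists_boundary_le_sum (hm : ∀ i, Measurable (Y i)) (hi : iIndepFun Y P)
    (hs : ∀ i, HasSubgaussianMGF (Y i) (1 / 4) P) (h0 : ∀ i, ∫ ω, Y i ω ∂P = 0)
    (hε : 0 < ε) (hη : η ∈ Set.Ioo (0 : ℝ) (Real.log (1 + ε) / Real.exp 1)) {k u v : ℕ}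
    (hu : 1 ≤ u) (hku : (1 + ε) ^ k ≤ (u : ℝ)) (hv : (v : ℝ) ≤ ε * u) :
    P {ω | ∃ i < v, √ε * boundary ε η (u + 1) ≤ ∑ s ∈ Finset.range (i + 1), Y (u + s) ω} ≤
      ENNReal.ofReal ((η / Real.log (1 + ε)) ^ (1 + ε) * ((k + 1 : ℕ) : ℝ) ^ (-(1 + ε))) := by
  rcases v with _ | m
  · simp
  have hu' : (1 : ℝ) ≤ u := by exact_mod_cast hu
  have h := measure_exists_sum_range_ge_le (Z := fun s => Y (u + s)) (by norm_num)
    (fun i => hm _) (hi.precomp (add_right_injective u)) (fun i => hs _) (fun i => h0 _)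
    (mul_nonneg (Real.sqrt_nonneg ε) (Real.sqrt_nonneg _) : 0 ≤ √ε * boundary ε η (u + 1)) m
  simp only [Nat.lt_succ_iff]
  refine h.trans (ENNReal.ofReal_le_ofReal (le_trans (Real.exp_le_exp.2 ?_)
    (exp_neg_log_log_le hε hη (x := u + 1) (by linarith))))
  have h1 := one_le_log_log_div hε hη (x := (u : ℝ) + 1) (by linarith)
  rw [mul_pow, boundary_sq hε hη (by linarith), Real.sq_sqrt hε.le, neg_div]
  refine neg_le_neg ?_
  set l := Real.log (Real.log ((1 + ε) * (u + 1)) / η)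
  have hm0 : (0 : ℝ) < (m + 1 : ℕ) := by positivity
  push_cast at hv hm0 ⊢
  rw [le_div_iff₀ (by positivity)]
  have : (m + 1 : ℝ) ≤ ε * (u + 1) := by linarith
  have h2 : (1 + ε) * l * (m + 1) ≤ (1 + ε) * l * (ε * (u + 1)) :=
    mul_le_mul_of_nonneg_left this (mul_nonneg (by linarith) (by linarith))
  linarith

/-- A finite-time law of the iterated logarithm for sub-Gaussian random variables. -/
lemma measure_exists_width_lt_sum (hm : ∀ i, Measurable (Y i)) (hi : iIndepFun Y P)
    (hs : ∀ i, HasSubgaussianMGF (Y i) (1 / 4) P) (h0 : ∀ i, ∫ ω, Y i ω ∂P = 0)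
    (hε : ε ∈ Set.Ioo (0 : ℝ) 1)
    (hη : η ∈ Set.Ioo (0 : ℝ) (Real.log (1 + ε) / Real.exp 1)) :
    P {ω | ∃ t : ℕ, 1 ≤ t ∧ t * width ε t η < ∑ s ∈ Finset.range t, Y s ω} ≤
      ENNReal.ofReal ((2 + ε) / ε * (η / Real.log (1 + ε)) ^ (1 + ε)) := by
  obtain ⟨hε0, hε1⟩ := hε
  have hL : 0 < Real.log (1 + ε) := Real.log_pos (by linarith)
  have hη0 := hη.1
  set q : ℝ := (η / Real.log (1 + ε)) ^ (1 + ε) with hq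
  have hq0 : 0 ≤ q := by positivity
  set u : ℕ → ℕ := fun k => ⌈(1 + ε) ^ k⌉₊ with hu
  -- The number of times strictly between `u k` and the start of the next block; truncated
  -- subtraction gives `0` when there are none.
  set v : ℕ → ℕ := fun k => ⌈(1 + ε) ^ (k + 1)⌉₊ - 1 - u k with hv
  have hu1 : ∀ k, 1 ≤ u k := fun k => Nat.one_le_ceil_iff.2 (by positivity)
  have huk : ∀ k, (1 + ε) ^ k ≤ (u k : ℝ) := fun k => Nat.le_ceil _
  have hvk : ∀ k, (v k : ℝ) ≤ ε * u k := by
    intro k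
    rcases Nat.eq_zero_or_pos (v k) with h | h
    · rw [h]; push_cast; positivity
    have h1 : v k + u k + 1 = ⌈(1 + ε) ^ (k + 1)⌉₊ := by simp only [hv] at h ⊢; omega
    have h2 : (⌈(1 + ε) ^ (k + 1)⌉₊ : ℝ) < (1 + ε) ^ (k + 1) + 1 :=
      Nat.ceil_lt_add_one (by positivity)
    rw [← h1] at h2
    push_cast at h2
    have h3 : (1 + ε) ^ (k + 1) ≤ (1 + ε) * u k := by
      rw [pow_succ']; exact mul_le_mul_of_nonneg_left (huk k) (by linarith)
    linarith
  set A : ℕ → Set Ω := fun k => {ω | boundary ε η (u k) ≤ ∑ s ∈ Finset.range (u k), Y s ω} with hA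
  set D : ℕ → Set Ω := fun k => {ω | ∃ i < v k,
    √ε * boundary ε η (u k + 1) ≤ ∑ s ∈ Finset.range (i + 1), Y (u k + s) ω} with hD
  have hPA : ∀ k, P (A k) ≤ ENNReal.ofReal (q * ((k + 1 : ℕ) : ℝ) ^ (-(1 + ε))) := fun k =>
    measure_boundary_le_sum hi hs hε0 hη (hu1 k) (huk k)
  have hPD : ∀ k, P (D k) ≤ ENNReal.ofReal (q * ((k + 1 : ℕ) : ℝ) ^ (-(1 + ε))) := fun k =>
    measure_exists_boundary_le_sum hm hi hs h0 hε0 hη (hu1 k) (huk k) (hvk k)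
  have hseries : ∑' k : ℕ, ENNReal.ofReal (q * ((k + 1 + 1 : ℕ) : ℝ) ^ (-(1 + ε))) ≤
      ENNReal.ofReal (q * ε⁻¹) := by
    refine ENNReal.tsum_le_of_sum_range_le fun N => ?_
    rw [← ENNReal.ofReal_sum_of_nonneg fun k _ => by positivity, ← Finset.mul_sum]
    exact ENNReal.ofReal_le_ofReal
      (mul_le_mul_of_nonneg_left (sum_inv_rpow_one_add_le hε0 N) hq0)
  have hsub : {ω | ∃ t : ℕ, 1 ≤ t ∧ t * width ε t η < ∑ s ∈ Finset.range t, Y s ω} ⊆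
      A 0 ∪ ((⋃ k, A (k + 1)) ∪ ⋃ k, D (k + 1)) := by
    rintro ω ⟨t, ht, hlt⟩
    rw [natCast_mul_width] at hlt
    by_contra hcon
    simp only [Set.mem_union, Set.mem_iUnion, not_or, not_exists] at hcon
    obtain ⟨hA0, hA1, hD1⟩ := hcon
    have ht' : (1 : ℝ) ≤ t := by exact_mod_cast ht
    obtain ⟨k, hk1, hk2⟩ := exists_nat_pow_near ht' (by linarith : 1 < 1 + ε)
    have hAk : ω ∉ A k := by
      cases k with
      | zero => exact hA0
      | succ k => exact hA1 k
    have hut : u k ≤ t := Nat.ceil_le.2 hk1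
    have hut' : (u k : ℝ) ≤ t := by exact_mod_cast hut
    have hu1' : (1 : ℝ) ≤ u k := by exact_mod_cast hu1 k
    have hb0 : 0 ≤ boundary ε η t := Real.sqrt_nonneg _
    have hAk' : ∑ s ∈ Finset.range (u k), Y s ω < boundary ε η t :=
      (not_le.1 hAk).trans_le (boundary_mono hε0 hη hu1' hut')
    rcases hut.eq_or_lt with h | h
    · rw [← h] at hlt hb0 hAk'
      nlinarith [Real.sqrt_nonneg ε, mul_nonneg (Real.sqrt_nonneg ε) hb0]
    have hDk : ω ∉ D k := by
      cases k with
      -- `D 0` is absent from the cover: since `1 + ε < 2`, block `0` contains no time after `1`.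
      -- Thus the total is `q (1 + 2 / ε)`, with no further term.
      | zero =>
        exfalso
        have h2 : (t : ℝ) < 2 := by rw [zero_add, pow_one] at hk2; linarith
        have h3 : t < 2 := by exact_mod_cast h2
        have := hu1 0
        omega
      | succ k => exact hD1 k
    have htc : t < ⌈(1 + ε) ^ (k + 1)⌉₊ := Nat.lt_ceil.2 hk2
    have hlt2 : ∑ s ∈ Finset.range (t - u k), Y (u k + s) ω < √ε * boundary ε η (u k + 1) := by
      by_contra hge
      refine hDk ⟨t - u k - 1, by simp only [hv]; omega, ?_⟩
      rw [show t - u k - 1 + 1 = t - u k by omega]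
      exact not_lt.1 hge
    have hmono : boundary ε η (u k + 1) ≤ boundary ε η t :=
      boundary_mono hε0 hη (by linarith) (by exact_mod_cast h)
    have hsplit : ∑ s ∈ Finset.range t, Y s ω =
        ∑ s ∈ Finset.range (u k), Y s ω + ∑ s ∈ Finset.range (t - u k), Y (u k + s) ω := by
      rw [← Finset.sum_range_add, Nat.add_sub_cancel' hut]
    have := mul_le_mul_of_nonneg_left hmono (Real.sqrt_nonneg ε)
    linarith
  have hU : ∀ S : ℕ → Set Ω, (∀ k, P (S k) ≤
      ENNReal.ofReal (q * ((k + 1 : ℕ) : ℝ) ^ (-(1 + ε)))) →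
      P (⋃ k, S (k + 1)) ≤ ENNReal.ofReal (q * ε⁻¹) := fun S hS =>
    (measure_iUnion_le _).trans ((ENNReal.tsum_le_tsum fun k => hS (k + 1)).trans hseries)
  calc P _ ≤ P (A 0 ∪ ((⋃ k, A (k + 1)) ∪ ⋃ k, D (k + 1))) := measure_mono hsub
    _ ≤ P (A 0) + (P (⋃ k, A (k + 1)) + P (⋃ k, D (k + 1))) :=
        (measure_union_le _ _).trans (add_le_add le_rfl (measure_union_le _ _))
    _ ≤ ENNReal.ofReal q + (ENNReal.ofReal (q * ε⁻¹) + ENNReal.ofReal (q * ε⁻¹)) :=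
        add_le_add ((hPA 0).trans (by simp)) (add_le_add (hU A hPA) (hU D hPD))
    _ = _ := by
        rw [← ENNReal.ofReal_add (by positivity) (by positivity),
          ← ENNReal.ofReal_add (by positivity) (by positivity)]
        congr 1
        field_simp
        ring

end IteratedLogarithm

/-! ### Simultaneous confidence intervals for all arms. -/

section ConfidenceEvent

variable {n : ℕ} {I : Instance n} {R : ℝ≥0} {Ω : Type*} [MeasurableSpace Ω] {P : Measure Ω}
  {X : Fin n → ℕ → Ω → ℝ} {ε δ : ℝ}

lemma div_natCast_mem_Ioo {a b : ℝ} {m : ℕ} (hm : 1 ≤ m) (ha : a ∈ Set.Ioo 0 b) :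
    a / m ∈ Set.Ioo 0 b := by
  have hm' : (1 : ℝ) ≤ m := by exact_mod_cast hm
  have := ha.1
  exact ⟨by positivity, (div_le_self this.le hm').trans_lt ha.2⟩

namespace Instance

lemma IsRewardModel.hasSubgaussianMGF (hX : I.IsRewardModel P X)
    (hR : R ≤ 1 / 2) (hsub : I.SubGaussianRewards R) (j : Fin n) (s : ℕ) :
    HasSubgaussianMGF (fun ω => X j s ω - I.mean j) (1 / 4) P := by
  have h := (hsub j).2
  rw [← hX.map_eq j s] at h
  have h' := HasSubgaussianMGF.of_map (hX.measurable j s).aemeasurable h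
  refine ⟨h'.integrable_exp_mul, fun t => (h'.mgf_le t).trans (Real.exp_le_exp.2 ?_)⟩
  have h2 : R ^ 2 ≤ 1 / 4 := by
    calc R ^ 2 ≤ (1 / 2) ^ 2 := by gcongr
      _ = 1 / 4 := by
        rw [div_pow]; norm_num
  have h3 : ((R ^ 2 : ℝ≥0) : ℝ) ≤ ((1 / 4 : ℝ≥0) : ℝ) := by exact_mod_cast h2
  gcongr

lemma IsRewardModel.integral_sub_mean [IsProbabilityMeasure P] (hX : I.IsRewardModel P X)
    (hR : R ≤ 1 / 2) (hsub : I.SubGaussianRewards R) (j : Fin n) (s : ℕ) :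
    ∫ ω, (X j s ω - I.mean j) ∂P = 0 := by
  have h1 := (hX.hasSubgaussianMGF hR hsub j s).integrable
  have h2 : Integrable (X j s) P := by
    refine (h1.add (integrable_const (I.mean j))).congr (ae_of_all _ fun ω => ?_)
    simp
  rw [integral_sub h2 (integrable_const _), mean, ← hX.map_eq j s,
    integral_map (hX.measurable j s).aemeasurable (by fun_prop)]
  simp

/-- The deviations of the empirical mean of an arm from its mean stay, in both directions, within
the confidence width at all times with high probability. -/
lemma IsRewardModel.measure_exists_width_lt [IsProbabilityMeasure P] (hX : I.IsRewardModel P X)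
    (hR : R ≤ 1 / 2) (hsub : I.SubGaussianRewards R) (hε : ε ∈ Set.Ioo (0 : ℝ) 1) {η : ℝ}
    (hη : η ∈ Set.Ioo (0 : ℝ) (Real.log (1 + ε) / Real.exp 1)) (j : Fin n) :
    P {ω | ∃ t : ℕ, 1 ≤ t ∧ width ε t η < |empMean (fun s => X j s ω) t - I.mean j|} ≤
      ENNReal.ofReal (2 * ((2 + ε) / ε * (η / Real.log (1 + ε)) ^ (1 + ε))) := by
  have hm : ∀ s, Measurable fun ω => X j s ω - I.mean j := fun s =>
    (hX.measurable j s).sub_const _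
  have hi : iIndepFun (fun s ω => X j s ω - I.mean j) P :=
    (hX.indep j).comp (fun _ x => x - I.mean j) fun _ => measurable_id.sub_const _
  have hs := hX.hasSubgaussianMGF hR hsub j
  have h0 := hX.integral_sub_mean hR hsub j
  have h1 := measure_exists_width_lt_sum hm hi hs h0 hε hη
  have h2 := measure_exists_width_lt_sum (Y := fun s ω => -(X j s ω - I.mean j))
    (fun s => (hm s).neg) (hi.comp (fun _ x => -x) fun _ => measurable_neg) (fun s => (hs s).neg)
    (fun s => by rw [integral_neg, h0, neg_zero]) hε hη
  refine (measure_mono ?_).trans ((measure_union_le _ _).trans ((add_le_add h1 h2).trans ?_))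
  · rintro ω ⟨t, ht, hlt⟩
    have ht' : (0 : ℝ) < t := by exact_mod_cast ht
    have hsum : t * (empMean (fun s => X j s ω) t - I.mean j) =
        ∑ s ∈ Finset.range t, (X j s ω - I.mean j) := by
      rw [Finset.sum_sub_distrib, empMean, mul_sub, mul_div_cancel₀ _ ht'.ne']
      simp
    rcases lt_abs.1 hlt with h | h
    · refine Or.inl ⟨t, ht, ?_⟩
      rw [← hsum]
      gcongr
    · refine Or.inr ⟨t, ht, ?_⟩
      rw [Finset.sum_neg_distrib, ← hsum, ← mul_neg]
      gcongr
  · have hL : 0 < Real.log (1 + ε) := Real.log_pos (by linarith [hε.1])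
    have := hε.1
    have := hη.1
    rw [← ENNReal.ofReal_add (by positivity) (by positivity), two_mul]

/-- The union bound over arms costs nothing: level `δ / n` contributes `n ^ (-(1 + ε))`, and `n * n
^ (-(1 + ε)) ≤ 1`. -/
lemma IsRewardModel.exists_confidence_event [IsProbabilityMeasure P] (hX : I.IsRewardModel P X)
    (hn : 1 ≤ n) (hR : R ≤ 1 / 2) (hsub : I.SubGaussianRewards R) (hε : ε ∈ Set.Ioo (0 : ℝ) 1)
    (hδ : δ ∈ Set.Ioo (0 : ℝ) (Real.log (1 + ε) / Real.exp 1)) :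
    ∃ E : Set Ω, MeasurableSet E ∧
      1 - (2 + ε) / (ε / 2) * (δ / Real.log (1 + ε)) ^ (1 + ε) ≤ P.real E ∧
      ∀ ω ∈ E, ∀ j, ∀ t : ℕ, 1 ≤ t →
        |empMean (fun s => X j s ω) t - I.mean j| ≤ width ε t (δ / n) := by
  have hη := div_natCast_mem_Ioo hn hδ
  have hL : 0 < Real.log (1 + ε) := Real.log_pos (by linarith [hε.1])
  have hε0 := hε.1
  have hδ0 := hδ.1
  have hn0 : (0 : ℝ) < n := by exact_mod_cast hn
  have hn1 : (1 : ℝ) ≤ n := by exact_mod_cast hn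
  set B : Fin n → Set Ω := fun j =>
    {ω | ∃ t : ℕ, 1 ≤ t ∧ width ε t (δ / n) < |empMean (fun s => X j s ω) t - I.mean j|} with hB
  have hBm : ∀ j, MeasurableSet (B j) := fun j => by
    have : B j = ⋃ t : ℕ, ⋃ _ : 1 ≤ t,
        {ω | width ε t (δ / n) < |empMean (fun s => X j s ω) t - I.mean j|} := by
      ext ω; simp [hB]
    rw [this]
    refine MeasurableSet.iUnion fun t => MeasurableSet.iUnion fun _ =>
      measurableSet_lt measurable_const ?_
    refine (Measurable.sub_const ?_ _).abs
    exact (Finset.measurable_fun_sum _ fun s _ => hX.measurable j s).div_const _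
  have hE : MeasurableSet (⋃ j, B j) := MeasurableSet.iUnion hBm
  refine ⟨(⋃ j, B j)ᶜ, hE.compl, ?_, fun ω hω j t ht => ?_⟩
  · rw [probReal_compl_eq_one_sub hE]
    have h1 : P (⋃ j, B j) ≤ ENNReal.ofReal
        (n * (2 * ((2 + ε) / ε * (δ / n / Real.log (1 + ε)) ^ (1 + ε)))) := by
      refine (measure_iUnion_fintype_le _ _).trans ((Finset.sum_le_sum fun j _ =>
        hX.measure_exists_width_lt hR hsub hε hη j).trans (le_of_eq ?_))
      rw [Finset.sum_const, Finset.card_univ, Fintype.card_fin,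
        ENNReal.ofReal_mul hn0.le, ENNReal.ofReal_natCast, nsmul_eq_mul]
    have h2 : P.real (⋃ j, B j) ≤ _ := ENNReal.toReal_le_of_le_ofReal (by positivity) h1
    have h3 : n * (2 * ((2 + ε) / ε * (δ / n / Real.log (1 + ε)) ^ (1 + ε))) ≤
        (2 + ε) / (ε / 2) * (δ / Real.log (1 + ε)) ^ (1 + ε) := by
      have h4 : (δ / n / Real.log (1 + ε)) ^ (1 + ε) =
          (δ / Real.log (1 + ε)) ^ (1 + ε) / (n : ℝ) ^ (1 + ε) := by
        rw [← Real.div_rpow (by positivity) hn0.le, div_right_comm]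
      have h5 : (n : ℝ) ≤ (n : ℝ) ^ (1 + ε) :=
        Real.self_le_rpow_of_one_le hn1 (by linarith)
      have h6 : n / (n : ℝ) ^ (1 + ε) ≤ 1 := (div_le_one (by positivity)).2 h5
      calc _ = (2 + ε) / (ε / 2) * (δ / Real.log (1 + ε)) ^ (1 + ε) * (n / (n : ℝ) ^ (1 + ε)) := by
            rw [h4]; ring
        _ ≤ _ := mul_le_of_le_one_right (by positivity) h6
    linarith
  · by_contra hlt
    exact hω (Set.mem_iUnion.2 ⟨j, t, ht, not_le.1 hlt⟩)

end Instance

end ConfidenceEvent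

/-! ### Inverting the width: from a gap to a number of pulls. -/

section SampleSize

variable {ε η D : ℝ}

lemma eight_le_gam (hε : 0 < ε) : 8 ≤ gam ε := by
  rw [gam]
  have : 1 ≤ (1 + √ε) ^ 2 := one_le_pow₀ (by linarith [Real.sqrt_nonneg ε])
  nlinarith

lemma two_le_log_gam (hε : 0 < ε) (hD : D ∈ Set.Ioc (0 : ℝ) 1) :
    2 ≤ Real.log (gam ε * (1 + ε) * (D ^ 2)⁻¹) := by
  have h1 := eight_le_gam hε
  have h2 : 1 ≤ (D ^ 2)⁻¹ := (one_le_inv₀ (pow_pos hD.1 2)).2 (pow_le_one₀ hD.1.le hD.2)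
  have h3 : 8 ≤ gam ε * (1 + ε) * (D ^ 2)⁻¹ := by
    have : 8 ≤ gam ε * (1 + ε) := by nlinarith
    nlinarith
  rw [Real.le_log_iff_exp_le (by linarith)]
  refine le_trans ?_ h3
  have := Real.exp_one_lt_d9
  have h4 : Real.exp 2 = Real.exp 1 ^ 2 := by rw [← Real.exp_nat_mul]; norm_num
  rw [h4]
  nlinarith [Real.exp_pos 1]

lemma two_le_log_log_gam (hε : ε ∈ Set.Ioo (0 : ℝ) 1)
    (hη : η ∈ Set.Ioo (0 : ℝ) (Real.log (1 + ε) / Real.exp 1)) (hD : D ∈ Set.Ioc (0 : ℝ) 1) :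
    2 ≤ Real.log (2 * Real.log (gam ε * (1 + ε) * (D ^ 2)⁻¹) / η) := by
  have h1 := two_le_log_gam hε.1 hD
  have hη0 := hη.1
  have h2 : Real.exp 1 * η ≤ 1 := by
    have h3 := hη.2
    rw [lt_div_iff₀ (Real.exp_pos 1)] at h3
    have := Real.log_le_sub_one_of_pos (by linarith [hε.1] : 0 < 1 + ε)
    linarith [hε.2]
  have h4 : Real.exp 2 = Real.exp 1 * Real.exp 1 := by rw [← Real.exp_add]; norm_num
  have h5 : Real.exp 2 ≤ 2 * Real.log (gam ε * (1 + ε) * (D ^ 2)⁻¹) / η := by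
    rw [le_div_iff₀ hη0, h4]
    have := Real.exp_one_lt_d9
    nlinarith [Real.exp_pos 1]
  exact (Real.le_log_iff_exp_le ((Real.exp_pos 2).trans_le h5)).2 h5

lemma natCast_le_of_le_four_mul_width (hε : ε ∈ Set.Ioo (0 : ℝ) 1)
    (hη : η ∈ Set.Ioo (0 : ℝ) (Real.log (1 + ε) / Real.exp 1)) (hD : 0 < D) {t : ℕ} (ht : 1 ≤ t)
    (h : D ≤ 4 * width ε t η) :
    (t : ℝ) ≤ gam ε / D ^ 2 * Real.log (Real.log ((1 + ε) * t) / η) := by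
  have ht1 : (1 : ℝ) ≤ t := by exact_mod_cast ht
  have h1 := one_le_log_log_div hε.1 hη ht1
  have hε0 := hε.1
  have h2 : D ^ 2 ≤ (4 * width ε t η) ^ 2 := by gcongr
  rw [width, mul_pow, mul_pow, Real.sq_sqrt (mul_nonneg (by positivity) (by linarith))] at h2
  rw [div_mul_eq_mul_div, le_div_iff₀ (by positivity)]
  set l := Real.log (Real.log ((1 + ε) * t) / η)
  calc t * D ^ 2 ≤ t * (4 ^ 2 * ((1 + √ε) ^ 2 * ((1 + ε) / (2 * t) * l))) := by gcongr
    _ = gam ε * l := by rw [gam]; field_simp; ring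

/-- The extra `2` pays for the last pull and for the one-epoch delay in updating the candidate
groups; see `pulls_le`. -/
lemma natCast_add_two_le_of_le_four_mul_width (hε : ε ∈ Set.Ioo (0 : ℝ) 1)
    (hη : η ∈ Set.Ioo (0 : ℝ) (Real.log (1 + ε) / Real.exp 1)) (hD : D ∈ Set.Ioc (0 : ℝ) 1)
    {t : ℕ} (ht : 1 ≤ t) (h : D ≤ 4 * width ε t η) :
    (t : ℝ) + 2 ≤ 2 * gam ε / D ^ 2 *
      Real.log (2 * Real.log (gam ε * (1 + ε) * (D ^ 2)⁻¹) / η) := by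
  have h1 := natCast_le_of_le_four_mul_width hε hη hD.1 ht h
  have hl := two_le_log_gam hε.1 hD
  have hLL := two_le_log_log_gam hε hη hD
  have hε0 := hε.1
  have hη0 := hη.1
  have hD0 := hD.1
  have ht1 : (1 : ℝ) ≤ t := by exact_mod_cast ht
  have hg := eight_le_gam hε0
  have hD2 : D ^ 2 ≤ 1 := pow_le_one₀ hD0.le hD.2
  set a := gam ε / D ^ 2 with ha
  have ha8 : 8 ≤ a := by rw [ha, le_div_iff₀ (by positivity)]; nlinarith
  set l := Real.log (gam ε * (1 + ε) * (D ^ 2)⁻¹) with hldef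
  set L := Real.log (2 * l / η) with hL
  set x := (t : ℝ) / a with hx
  have hx0 : 0 < x := by positivity
  have htx : (t : ℝ) = a * x := by rw [hx]; field_simp
  have hlog : Real.log ((1 + ε) * t) = l + Real.log x := by
    rw [hldef, ← Real.log_mul (by positivity) hx0.ne', htx, ha]
    congr 1; ring
  have hpos : 0 < l + Real.log x := by rw [← hlog]; exact Real.log_pos (by nlinarith)
  have hLsplit : L = Real.log 2 + Real.log (l / η) := by
    rw [hL, mul_div_assoc, Real.log_mul two_ne_zero (by positivity)]
  have hlog2 : 0 < Real.log 2 := Real.log_pos one_lt_two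
  have hx1 : x ≤ Real.log ((l + Real.log x) / η) := by
    rw [hlog] at h1
    have : a * x ≤ a * Real.log ((l + Real.log x) / η) := by rw [← htx]; exact h1
    exact le_of_mul_le_mul_left this (by linarith)
  -- For `x ≥ 1`, concavity of the logarithm and `l ≥ 2` give `x ≤ L - log 2 + (x - 1) / 2`, which
  -- is solved for `x`. The slack `1 / 4`, multiplied by `a ≥ 8`, yields the extra `2`.
  have hx2 : x ≤ 2 * L - 1 / 4 := by
    rcases le_total x 1 with hle | hge
    · linarith
    have hlx : Real.log x ≤ x - 1 := Real.log_le_sub_one_of_pos hx0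
    have hlx0 : 0 ≤ Real.log x := Real.log_nonneg hge
    have h3 : (l + Real.log x) / η = l / η * (1 + Real.log x / l) := by field_simp
    have h4 : Real.log (1 + Real.log x / l) ≤ Real.log x / l := by
      have := Real.log_le_sub_one_of_pos (by positivity : 0 < 1 + Real.log x / l)
      linarith
    have h5 : Real.log x / l ≤ Real.log x / 2 := by gcongr
    rw [h3, Real.log_mul (by positivity) (by positivity)] at hx1
    linarith
  rw [htx, show 2 * gam ε / D ^ 2 = 2 * a by rw [ha]; ring]
  nlinarith

end SampleSize

/-! ### Elementary properties of the gaps. -/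

section Gaps

namespace Instance

variable {n : ℕ} {I : Instance n} {R : ℝ≥0} {G Gs : Finset (Fin n)} {j : Fin n}

lemma worstMean_le (hj : j ∈ G) : I.worstMean G ≤ I.mean j :=
  ciInf_le (f := fun j : {j // j ∈ G} => I.mean j) (Set.finite_range _).bddBelow ⟨j, hj⟩

lemma exists_mean_eq_worstMean (hG : G.Nonempty) : ∃ j ∈ G, I.mean j = I.worstMean G := by
  have : Nonempty {j // j ∈ G} := hG.to_subtype
  obtain ⟨⟨j, hj⟩, h⟩ := exists_eq_ciInf_of_finite (f := fun j : {j // j ∈ G} => I.mean j)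
  exact ⟨j, hj, h⟩

lemma worstMean_le_of_isUniqueOptimal (hGs : I.IsUniqueOptimal Gs) (hG : G ∈ I.groups) :
    I.worstMean G ≤ I.worstMean Gs := by
  rcases eq_or_ne G Gs with rfl | h
  · exact le_rfl
  · exact (hGs.2 G hG h).le

lemma finite_groups_subtype (p : Finset (Fin n) → Prop) : Finite {G // G ∈ I.groups ∧ p G} :=
  Finite.of_injective (fun G => (⟨G.1, G.2.1⟩ : {G // G ∈ I.groups})) fun a b h => by
    simpa [Subtype.ext_iff] using h

lemma gapWithin_le (hG : G ∈ I.groups) (hj : j ∈ G) :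
    I.gapWithin j ≤ I.mean j - I.worstMean G := by
  have := I.finite_groups_subtype fun G => j ∈ G
  exact ciInf_le (f := fun G : {G // G ∈ I.groups ∧ j ∈ G} => I.mean j - I.worstMean G)
    (Set.finite_range _).bddBelow ⟨G, hG, hj⟩

lemma gapAcross_le (hG : G ∈ I.groups) (hj : j ∈ G) : I.gapAcross Gs j ≤ I.groupGap Gs G := by
  have := I.finite_groups_subtype fun G => j ∈ G
  exact ciInf_le (f := fun G : {G // G ∈ I.groups ∧ j ∈ G} => I.groupGap Gs G)
    (Set.finite_range _).bddBelow ⟨G, hG, hj⟩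

lemma gapZero_le (hG : G ∈ I.groups) (hne : G ≠ Gs) : I.gapZero Gs ≤ I.groupGap Gs G := by
  have := I.finite_groups_subtype fun G => G ≠ Gs
  exact ciInf_le (f := fun G : {G // G ∈ I.groups ∧ G ≠ Gs} => I.groupGap Gs G)
    (Set.finite_range _).bddBelow ⟨G, hG, hne⟩

lemma gapZero_pos (hI : 2 ≤ I.groups.card) (hGs : I.IsUniqueOptimal Gs) : 0 < I.gapZero Gs := by
  have := I.finite_groups_subtype fun G => G ≠ Gs
  obtain ⟨G, hG, hne⟩ := Finset.exists_mem_ne hI Gs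
  have : Nonempty {G // G ∈ I.groups ∧ G ≠ Gs} := ⟨⟨G, hG, hne⟩⟩
  obtain ⟨⟨G, hG, hne⟩, h⟩ := exists_eq_ciInf_of_finite
    (f := fun G : {G // G ∈ I.groups ∧ G ≠ Gs} => I.groupGap Gs G)
  rw [gapZero, ← h]
  exact sub_pos.2 (hGs.2 G hG hne)

lemma worstMean_mem_Icc (hsub : I.SubGaussianRewards R) (hG : G ∈ I.groups) :
    I.worstMean G ∈ Set.Icc (0 : ℝ) 1 := by
  obtain ⟨j, -, h⟩ := I.exists_mean_eq_worstMean (I.groups_nonempty G hG)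
  exact h ▸ (hsub j).1

lemma gapZero_mem_Ioc (hsub : I.SubGaussianRewards R) (hI : 2 ≤ I.groups.card)
    (hGs : I.IsUniqueOptimal Gs) : I.gapZero Gs ∈ Set.Ioc (0 : ℝ) 1 := by
  refine ⟨gapZero_pos hI hGs, ?_⟩
  obtain ⟨G, hG, hne⟩ := Finset.exists_mem_ne hI Gs
  have h1 := worstMean_mem_Icc hsub hG
  have h2 := worstMean_mem_Icc hsub hGs.1
  have h3 := gapZero_le hG hne
  rw [groupGap] at h3
  linarith [h1.1, h2.2]

lemma gap_mem_Ioc (hsub : I.SubGaussianRewards R) (hI : 2 ≤ I.groups.card)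
    (hGs : I.IsUniqueOptimal Gs) (j : Fin n) : I.gap Gs j ∈ Set.Ioc (0 : ℝ) 1 := by
  have h0 := gapZero_mem_Ioc hsub hI hGs
  refine ⟨lt_max_of_lt_right (lt_max_of_lt_right h0.1), max_le ?_ (max_le ?_ h0.2)⟩
  all_goals
    obtain ⟨G, hG, hj⟩ := I.cover j
    have h1 := worstMean_mem_Icc hsub hG
    have h2 := worstMean_mem_Icc hsub hGs.1
    have h3 := (hsub j).1
  · linarith [gapWithin_le hG hj, h1.1, h3.2]
  · have h4 := gapAcross_le (Gs := Gs) hG hj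
    rw [groupGap] at h4
    linarith [h1.1, h2.2]

end Instance

end Gaps

/-! ### Invariants of the algorithm valid for every reward table. -/

section Execution

variable {n : ℕ} {𝒢 : Finset (Finset (Fin n))} {ε δ : ℝ} {x : Fin n → ℕ → ℝ}

lemma width_nonneg (ε : ℝ) (t : ℕ) (η : ℝ) : 0 ≤ width ε t η := by
  unfold width; positivity

lemma state_succ (i : ℕ) :
    state 𝒢 ε δ x (i + 1) = State.step ε δ x (state 𝒢 ε δ x i) :=
  Function.iterate_succ_apply' _ _ _

lemma mem_cand_succ {i : ℕ} {G : Finset (Fin n)} :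
    G ∈ (state 𝒢 ε δ x (i + 1)).cand ↔ G ∈ (state 𝒢 ε δ x i).cand ∧
      ∀ G' ∈ (state 𝒢 ε δ x i).cand,
        ((state 𝒢 ε δ x i).worst G').inf (lcb ε δ x (state 𝒢 ε δ x i).pulls) ≤
          ((state 𝒢 ε δ x i).worst G).inf (ucb ε δ x (state 𝒢 ε δ x i).pulls) := by
  rw [state_succ]; simp [State.step]

lemma cand_succ_subset (i : ℕ) :
    (state 𝒢 ε δ x (i + 1)).cand ⊆ (state 𝒢 ε δ x i).cand := fun _ h => (mem_cand_succ.1 h).1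

lemma cand_subset (i : ℕ) : (state 𝒢 ε δ x i).cand ⊆ 𝒢 := by
  induction i with
  | zero => exact Finset.Subset.refl _
  | succ i ih => exact (cand_succ_subset i).trans ih

lemma worst_succ (i : ℕ) :
    (state 𝒢 ε δ x (i + 1)).worst = potentialWorst ε δ x (state 𝒢 ε δ x (i + 1)).pulls := by
  rw [state_succ]; rfl

lemma worst_subset {i : ℕ} {G : Finset (Fin n)} :
    (state 𝒢 ε δ x i).worst G ⊆ G := by
  cases i with
  | zero => exact Finset.Subset.refl G
  | succ i => rw [worst_succ]; exact Finset.filter_subset _ _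

lemma mem_arms_succ {i : ℕ} {j : Fin n} :
    j ∈ (state 𝒢 ε δ x (i + 1)).arms ↔ j ∈ (state 𝒢 ε δ x i).arms ∧
      ∃ G ∈ (state 𝒢 ε δ x (i + 1)).cand, j ∈ (state 𝒢 ε δ x (i + 1)).worst G := by
  rw [state_succ]; simp [State.step]

lemma arms_antitone : Antitone fun i => (state 𝒢 ε δ x i).arms :=
  antitone_nat_of_succ_le fun _ _ h => (mem_arms_succ.1 h).1

lemma pulls_succ (i : ℕ) (j : Fin n) : (state 𝒢 ε δ x (i + 1)).pulls j =
    if j ∈ (state 𝒢 ε δ x i).arms then (state 𝒢 ε δ x i).pulls j + 1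
      else (state 𝒢 ε δ x i).pulls j := by
  rw [state_succ]; rfl

lemma pulls_eq_of_mem_arms {i : ℕ} {j : Fin n} (hj : j ∈ (state 𝒢 ε δ x i).arms) :
    (state 𝒢 ε δ x i).pulls j = i := by
  induction i with
  | zero => rfl
  | succ i ih =>
    have h := (mem_arms_succ.1 hj).1
    rw [pulls_succ, if_pos h, ih h]

/-- Elimination is permanent, so the pulls of an arm occupy an initial segment of the epochs. -/
lemma lt_and_mem_arms_of_lt_pulls {i k : ℕ} {j : Fin n} (hk : k < (state 𝒢 ε δ x i).pulls j) :
    k < i ∧ j ∈ (state 𝒢 ε δ x k).arms := by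
  induction i with
  | zero => exact absurd hk (Nat.not_lt_zero k)
  | succ i ih =>
    rw [pulls_succ] at hk
    split_ifs at hk with h
    · rw [pulls_eq_of_mem_arms h] at hk
      exact ⟨hk, arms_antitone (Nat.lt_succ_iff.1 hk) h⟩
    · exact ⟨(ih hk).1.trans (Nat.lt_succ_self i), (ih hk).2⟩

end Execution

/-! ### Deterministic analysis on the confidence event. -/

section Analysis

variable {n : ℕ} {I : Instance n} {ε δ : ℝ} {x : Fin n → ℕ → ℝ}

/-- All confidence intervals computed from the reward table `x` contain the corresponding mean. -/
def Instance.Confident (I : Instance n) (ε δ : ℝ) (x : Fin n → ℕ → ℝ) : Prop :=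
  ∀ j, ∀ t : ℕ, 1 ≤ t → |empMean (x j) t - I.mean j| ≤ width ε t (δ / n)

namespace Instance.Confident

variable {Gs G : Finset (Fin n)} {j : Fin n} {i : ℕ} {T : Fin n → ℕ}

lemma lcb_le_mean (h : I.Confident ε δ x) : lcb ε δ x T j ≤ (I.mean j : EReal) := by
  rw [lcb]
  split_ifs with h0
  · exact bot_le
  · rw [EReal.coe_le_coe_iff]
    linarith [(abs_le.1 (h j (T j) (Nat.one_le_iff_ne_zero.2 h0))).2]

lemma mean_le_ucb (h : I.Confident ε δ x) : (I.mean j : EReal) ≤ ucb ε δ x T j := by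
  rw [ucb]
  split_ifs with h0
  · exact le_top
  · rw [EReal.coe_le_coe_iff]
    linarith [(abs_le.1 (h j (T j) (Nat.one_le_iff_ne_zero.2 h0))).1]

lemma sub_le_lcb (h : I.Confident ε δ x) (hT : 1 ≤ T j) :
    ((I.mean j - 2 * width ε (T j) (δ / n) : ℝ) : EReal) ≤ lcb ε δ x T j := by
  rw [lcb, if_neg (Nat.one_le_iff_ne_zero.1 hT), EReal.coe_le_coe_iff]
  linarith [(abs_le.1 (h j (T j) hT)).1]

lemma ucb_le_add (h : I.Confident ε δ x) (hT : 1 ≤ T j) :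
    ucb ε δ x T j ≤ ((I.mean j + 2 * width ε (T j) (δ / n) : ℝ) : EReal) := by
  rw [ucb, if_neg (Nat.one_le_iff_ne_zero.1 hT), EReal.coe_le_coe_iff]
  linarith [(abs_le.1 (h j (T j) hT)).2]

lemma worstMean_le_inf_ucb (h : I.Confident ε δ x) {W : Finset (Fin n)} (hW : W ⊆ G) :
    (I.worstMean G : EReal) ≤ W.inf (ucb ε δ x T) :=
  Finset.le_inf fun _ hj =>
    (EReal.coe_le_coe_iff.2 (worstMean_le (hW hj))).trans h.mean_le_ucb

lemma mem_potentialWorst (h : I.Confident ε δ x) (hj : j ∈ G) (hjm : I.mean j = I.worstMean G) :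
    j ∈ potentialWorst ε δ x T G :=
  Finset.mem_filter.2 ⟨hj, h.lcb_le_mean.trans
    (hjm ▸ h.worstMean_le_inf_ucb (Finset.Subset.refl G))⟩

lemma mem_worst (h : I.Confident ε δ x) (hj : j ∈ G) (hjm : I.mean j = I.worstMean G) :
    j ∈ (state I.groups ε δ x i).worst G := by
  cases i with
  | zero => exact hj
  | succ i => rw [worst_succ]; exact h.mem_potentialWorst hj hjm

lemma optimal_mem_cand (h : I.Confident ε δ x) (hGs : I.IsUniqueOptimal Gs) :
    Gs ∈ (state I.groups ε δ x i).cand := by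
  induction i with
  | zero => exact hGs.1
  | succ i ih =>
    refine mem_cand_succ.2 ⟨ih, fun G' hG' => ?_⟩
    have hG := cand_subset i hG'
    obtain ⟨j, hj, hjm⟩ := I.exists_mean_eq_worstMean (I.groups_nonempty G' hG)
    calc _ ≤ lcb ε δ x (state I.groups ε δ x i).pulls j := Finset.inf_le (h.mem_worst hj hjm)
      _ ≤ (I.worstMean G' : EReal) := hjm ▸ h.lcb_le_mean
      _ ≤ (I.worstMean Gs : EReal) :=
        EReal.coe_le_coe_iff.2 (worstMean_le_of_isUniqueOptimal hGs hG)
      _ ≤ _ := h.worstMean_le_inf_ucb worst_subset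

lemma worst_arm_mem_arms (h : I.Confident ε δ x) (hG : G ∈ (state I.groups ε δ x i).cand)
    (hj : j ∈ G) (hjm : I.mean j = I.worstMean G) : j ∈ (state I.groups ε δ x i).arms := by
  induction i with
  | zero => exact Finset.mem_univ j
  | succ i ih =>
    exact mem_arms_succ.2 ⟨ih (cand_succ_subset i hG), G, hG, h.mem_worst hj hjm⟩

/-- Eliminated arms keep stale, possibly wide intervals. Since `Gs` is always a candidate, an arm of
`Gs` can be eliminated only when its lower bound exceeds the least upper bound in `Gs`, hence is at
least `μ(Gs)`; afterwards that bound is frozen. -/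
lemma worstMean_le_lcb_of_notMem_arms (h : I.Confident ε δ x) (hGs : I.IsUniqueOptimal Gs)
    (hj : j ∈ Gs) (hji : j ∉ (state I.groups ε δ x i).arms) :
    (I.worstMean Gs : EReal) ≤ lcb ε δ x (state I.groups ε δ x i).pulls j := by
  induction i with
  | zero => exact absurd (Finset.mem_univ j) hji
  | succ i ih =>
    by_cases hj' : j ∈ (state I.groups ε δ x i).arms
    · have hw : j ∉ (state I.groups ε δ x (i + 1)).worst Gs := fun hw =>
        hji (mem_arms_succ.2 ⟨hj', Gs, h.optimal_mem_cand hGs, hw⟩)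
      rw [worst_succ, potentialWorst, Finset.mem_filter, not_and, not_le] at hw
      exact (h.worstMean_le_inf_ucb (Finset.Subset.refl Gs)).trans (hw hj).le
    · have hp : (state I.groups ε δ x (i + 1)).pulls j = (state I.groups ε δ x i).pulls j := by
        rw [pulls_succ, if_neg hj']
      have := ih hj'
      rwa [lcb, ← hp] at this

lemma sub_le_inf_lcb (h : I.Confident ε δ x) (hGs : I.IsUniqueOptimal Gs) (hi : 1 ≤ i) :
    ((I.worstMean Gs - 2 * width ε i (δ / n) : ℝ) : EReal) ≤
      ((state I.groups ε δ x i).worst Gs).inf (lcb ε δ x (state I.groups ε δ x i).pulls) := by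
  refine Finset.le_inf fun j hj => ?_
  have hjG := worst_subset hj
  have hw := width_nonneg ε i (δ / n)
  by_cases ha : j ∈ (state I.groups ε δ x i).arms
  · have hp := pulls_eq_of_mem_arms ha
    refine le_trans ?_ (h.sub_le_lcb (hp.symm ▸ hi))
    rw [hp, EReal.coe_le_coe_iff]
    linarith [I.worstMean_le hjG]
  · refine le_trans ?_ (h.worstMean_le_lcb_of_notMem_arms hGs hjG ha)
    rw [EReal.coe_le_coe_iff]
    linarith

/-- A worst arm of a candidate group is still active, so it has exactly `i` pulls and its interval
is up to date. The set `W` is `G` in the arm test and the potential worst arms in the group test. -/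
lemma inf_ucb_le_add (h : I.Confident ε δ x) (hi : 1 ≤ i)
    (hG : G ∈ (state I.groups ε δ x i).cand) {W : Finset (Fin n)}
    (hW : ∀ j ∈ G, I.mean j = I.worstMean G → j ∈ W) :
    W.inf (ucb ε δ x (state I.groups ε δ x i).pulls) ≤
      ((I.worstMean G + 2 * width ε i (δ / n) : ℝ) : EReal) := by
  obtain ⟨j, hj, hjm⟩ := I.exists_mean_eq_worstMean (I.groups_nonempty G (cand_subset i hG))
  have hp := pulls_eq_of_mem_arms (h.worst_arm_mem_arms hG hj hjm)
  have h1 := h.ucb_le_add (j := j) (T := (state I.groups ε δ x i).pulls) (hp.symm ▸ hi)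
  rw [hp, hjm] at h1
  exact (Finset.inf_le (hW j hj hjm)).trans h1

lemma groupGap_le (h : I.Confident ε δ x) (hGs : I.IsUniqueOptimal Gs) (hi : 1 ≤ i)
    (hG : G ∈ (state I.groups ε δ x (i + 1)).cand) :
    I.groupGap Gs G ≤ 4 * width ε i (δ / n) := by
  obtain ⟨hG', hle⟩ := mem_cand_succ.1 hG
  have h1 := (h.sub_le_inf_lcb hGs hi).trans ((hle Gs (h.optimal_mem_cand hGs)).trans
    (h.inf_ucb_le_add hi hG' fun j hj hjm => h.mem_worst hj hjm))
  rw [EReal.coe_le_coe_iff] at h1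
  rw [groupGap]
  linarith

lemma gapWithin_le_of_mem_arms (h : I.Confident ε δ x) (hi : 1 ≤ i)
    (hj : j ∈ (state I.groups ε δ x i).arms) : I.gapWithin j ≤ 4 * width ε i (δ / n) := by
  obtain ⟨i, rfl⟩ := Nat.exists_eq_add_of_le' hi
  obtain ⟨-, G, hG, hjw⟩ := mem_arms_succ.1 hj
  have hp := pulls_eq_of_mem_arms hj
  rw [worst_succ, potentialWorst, Finset.mem_filter] at hjw
  have h1 := h.sub_le_lcb (j := j) (T := (state I.groups ε δ x (i + 1)).pulls) (hp.symm ▸ hi)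
  rw [hp] at h1
  have h2 := h1.trans (hjw.2.trans (h.inf_ucb_le_add hi hG fun j hj _ => hj))
  rw [EReal.coe_le_coe_iff] at h2
  linarith [gapWithin_le (cand_subset _ hG) hjw.1]

lemma gapAcross_le_of_mem_arms (h : I.Confident ε δ x) (hGs : I.IsUniqueOptimal Gs) (hi : 1 ≤ i)
    (hj : j ∈ (state I.groups ε δ x (i + 1)).arms) :
    I.gapAcross Gs j ≤ 4 * width ε i (δ / n) := by
  obtain ⟨-, G, hG, hjw⟩ := mem_arms_succ.1 hj
  exact (gapAcross_le (cand_subset _ hG) (worst_subset hjw)).trans (h.groupGap_le hGs hi hG)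

lemma gapZero_le_of_one_lt_card (h : I.Confident ε δ x) (hGs : I.IsUniqueOptimal Gs) (hi : 1 ≤ i)
    (hc : 1 < (state I.groups ε δ x (i + 1)).cand.card) :
    I.gapZero Gs ≤ 4 * width ε i (δ / n) := by
  obtain ⟨G, hG, hne⟩ := Finset.exists_mem_ne hc Gs
  exact (gapZero_le (cand_subset _ hG) hne).trans (h.groupGap_le hGs hi hG)

/-- The index `i + 1` is needed because candidate groups at `i + 1` were tested with the bounds of
epoch `i`. -/
lemma gap_le (h : I.Confident ε δ x) (hGs : I.IsUniqueOptimal Gs) (hi : 1 ≤ i)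
    (hj : j ∈ (state I.groups ε δ x (i + 1)).arms)
    (hc : 1 < (state I.groups ε δ x (i + 1)).cand.card) :
    I.gap Gs j ≤ 4 * width ε i (δ / n) :=
  max_le (h.gapWithin_le_of_mem_arms hi (arms_antitone (Nat.le_succ i) hj))
    (max_le (h.gapAcross_le_of_mem_arms hGs hi hj) (h.gapZero_le_of_one_lt_card hGs hi hc))

variable {R : ℝ≥0}

lemma exists_card_cand_le_one (h : I.Confident ε δ x) (hI : 2 ≤ I.groups.card)
    (hsub : I.SubGaussianRewards R) (hGs : I.IsUniqueOptimal Gs) (hε : ε ∈ Set.Ioo (0 : ℝ) 1)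
    (hη : δ / n ∈ Set.Ioo (0 : ℝ) (Real.log (1 + ε) / Real.exp 1)) :
    ∃ i, ¬ 1 < (state I.groups ε δ x i).cand.card := by
  by_contra! hcon
  have hb := fun i : ℕ => natCast_add_two_le_of_le_four_mul_width hε hη
    (gapZero_mem_Ioc hsub hI hGs) (Nat.le_add_left 1 i)
    (h.gapZero_le_of_one_lt_card hGs (Nat.le_add_left 1 i) (hcon _))
  obtain ⟨N, hN⟩ := exists_nat_gt (2 * gam ε / I.gapZero Gs ^ 2 *
    Real.log (2 * Real.log (gam ε * (1 + ε) * (I.gapZero Gs ^ 2)⁻¹) / (δ / n)))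
  have := hb N
  push_cast at this
  linarith

lemma pulls_le (h : I.Confident ε δ x) (hI : 2 ≤ I.groups.card)
    (hsub : I.SubGaussianRewards R) (hGs : I.IsUniqueOptimal Gs) (hε : ε ∈ Set.Ioo (0 : ℝ) 1)
    (hη : δ / n ∈ Set.Ioo (0 : ℝ) (Real.log (1 + ε) / Real.exp 1))
    (hc : ∀ k < i, 1 < (state I.groups ε δ x k).cand.card) (j : Fin n) :
    ((state I.groups ε δ x i).pulls j : ℝ) ≤ 2 * gam ε / I.gap Gs j ^ 2 *
      Real.log (2 * Real.log (gam ε * (1 + ε) * (I.gap Gs j ^ 2)⁻¹) / (δ / n)) := by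
  have hD := gap_mem_Ioc hsub hI hGs j
  rcases le_or_gt ((state I.groups ε δ x i).pulls j) 2 with hle | hgt
  · have h1 : ((state I.groups ε δ x i).pulls j : ℝ) ≤ 2 := by exact_mod_cast hle
    have h2 := two_le_log_log_gam hε hη hD
    have h3 : 2 ≤ 2 * gam ε / I.gap Gs j ^ 2 := by
      rw [le_div_iff₀ (pow_pos hD.1 2)]
      linarith [eight_le_gam hε.1, pow_le_one₀ (n := 2) hD.1.le hD.2]
    nlinarith
  -- With `t + 3` pulls, the last one occurs in epoch `t + 2`, whose candidate groups rest on the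
  -- bounds after `t + 1` pulls; hence `(t + 1) + 2`.
  · obtain ⟨t, ht⟩ := Nat.exists_eq_add_of_le' hgt
    obtain ⟨hlt, hmem⟩ := lt_and_mem_arms_of_lt_pulls
      (show t + 2 < (state I.groups ε δ x i).pulls j by omega)
    have := natCast_add_two_le_of_le_four_mul_width hε hη hD (Nat.le_add_left 1 t)
      (h.gap_le hGs (Nat.le_add_left 1 t) hmem (hc _ hlt))
    rw [ht]
    push_cast at this ⊢
    linarith

lemma exists_stopsIn (h : I.Confident ε δ x) (hI : 2 ≤ I.groups.card)
    (hsub : I.SubGaussianRewards R) (hGs : I.IsUniqueOptimal Gs) (hε : ε ∈ Set.Ioo (0 : ℝ) 1)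
    (hη : δ / n ∈ Set.Ioo (0 : ℝ) (Real.log (1 + ε) / Real.exp 1)) :
    ∃ S : State n, StopsIn I.groups ε δ x S ∧ S.cand = {Gs} ∧
      (S.totalPulls : ℝ) ≤ ∑ j, 2 * gam ε / I.gap Gs j ^ 2 *
        Real.log (2 * Real.log (gam ε * (1 + ε) * (I.gap Gs j ^ 2)⁻¹) / (δ / n)) := by
  classical
  -- `state` keeps iterating after the loop ends, so the invariants hold at every index and the
  -- actual stop is the first index with at most one candidate.
  have hex := h.exists_card_cand_le_one hI hsub hGs hε hη
  have hmin : ∀ k < Nat.find hex, 1 < (state I.groups ε δ x k).cand.card := fun k hk =>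
    not_not.1 (Nat.find_min hex hk)
  refine ⟨_, ⟨Nat.find hex, rfl, Nat.find_spec hex, hmin⟩, ?_, ?_⟩
  · exact Finset.Subset.antisymm
      (fun G hG => Finset.mem_singleton.2 (Finset.card_le_one.1 (not_lt.1 (Nat.find_spec hex)) G hG
        Gs (h.optimal_mem_cand hGs)))
      (Finset.singleton_subset_iff.2 (h.optimal_mem_cand hGs))
  · rw [State.totalPulls, Nat.cast_sum]
    exact Finset.sum_le_sum fun j _ => h.pulls_le hI hsub hGs hε hη hmin j

end Instance.Confident

end Analysis

end MaxMinBandit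

theorem mainTheorem1 {n : ℕ} (I : MaxMinBandit.Instance n) (hI : 2 ≤ I.groups.card)
    (R : ℝ≥0) (hR : R ≤ 1 / 2) (hsub : I.SubGaussianRewards R)
    (Gs : Finset (Fin n)) (hGs : I.IsUniqueOptimal Gs)
    {Ω : Type*} [MeasurableSpace Ω] (P : Measure Ω) [IsProbabilityMeasure P]
    (X : Fin n → ℕ → Ω → ℝ) (hX : I.IsRewardModel P X)
    (ε δ : ℝ) (hε : ε ∈ Set.Ioo (0 : ℝ) 1)
    (hδ : δ ∈ Set.Ioo (0 : ℝ) (Real.log (1 + ε) / Real.exp 1)) :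
    ∃ E : Set Ω, MeasurableSet E ∧
      1 - (2 + ε) / (ε / 2) * (δ / Real.log (1 + ε)) ^ (1 + ε) ≤ P.real E ∧
      ∀ ω ∈ E, ∃ S : MaxMinBandit.State n, MaxMinBandit.StopsIn I.groups ε δ (fun j s => X j s ω) S ∧
        S.cand = {Gs} ∧
        (S.totalPulls : ℝ) ≤ ∑ j, 2 * MaxMinBandit.gam ε / I.gap Gs j ^ 2 *
          Real.log (2 * Real.log (MaxMinBandit.gam ε * (1 + ε) * (I.gap Gs j ^ 2)⁻¹) / (δ / n)) := by
  have hn : 1 ≤ n := by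
    obtain ⟨j, -⟩ := I.groups_nonempty Gs hGs.1
    exact Nat.one_le_iff_ne_zero.2 fun h => (h ▸ j).elim0
  obtain ⟨E, hE, hP, hconf⟩ := hX.exists_confidence_event hn hR hsub hε hδ
  exact ⟨E, hE, hP, fun ω hω => MaxMinBandit.Instance.Confident.exists_stopsIn (hconf ω hω) hI hsub
    hGs hε (MaxMinBandit.div_natCast_mem_Ioo hn hδ)⟩
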